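/- Let $(\mathcal X,\mu)$ be a probability space and let $k:\mathcal X\times\mathcal X\to\mathbb R$ be a (symmetric) positive semi-definite kernel, jointly measurable, with $\int_{\mathcal X}k(x,x)\,\mathrm d\mu(x)<\infty$. Let $\sigma_1\ge\sigma_2\ge\cdots\ge 0$ be the eigenvalues, counted with multiplicity (and padded with zeros if there are only finitely many positive ones), of the integral operator $\mathcal K:L^2(\mu)\to L^2(\mu)$, $(\mathcal Kf)(x)=\int_{\mathcal X}k(x,y)f(y)\,\mathrm d\mu(y)$. Let $Z=(z_i)_{i=1}^\ell$ be any points of $\mathcal X$. Write $k(Z,Z)=(k(z_i,z_j))_{i,j=1}^\ell$, $k(Z,x)=(k(z_i,x))_{i=1}^\ell$, $h_\mu(x,y)=\int_{\mathcal X}k(x,t)k(t,y)\,\mathrm d\mu(t)$, $h_\mu(Z,Z)=(h_\mu(z_i,z_j))_{i,j=1}^\ell$, and let $A^+$ denote the Moore–Penrose pseudo-inverse of a matrix $A$. Let $H\in\mathbb R^{\ell\times\ell}$ be any matrix with $H^\top H=h_\mu(Z,Z)$, and let $$Hk(Z,Z)^+H^\top=V\operatorname{diag}(\kappa_1,\dots,\kappa_\ell)V^\top$$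 with $V=[v_1,\dots,v_\ell]$ orthogonal and $\kappa_1\ge\cdots\ge\kappa_\ell\ge0$. Put $f_i(x)=(H^+v_i)^\top k(Z,x)$ for $1\le i\le\ell$, and, for $0\le s\le\ell$, $$k^Z_\mu(x,y)=\sum_{i=1}^{\ell}\kappa_if_i(x)f_i(y),\qquad k^Z_{s,\mu}(x,y)=\sum_{i=1}^{s}\kappa_if_i(x)f_i(y),$$ which are the Mercer decomposition with respect to $\mu$ of the Nyström kernel $k^Z(x,y)=k(x,Z)k(Z,Z)^+k(Z,y)$, and its truncation. Then $\kappa_i\le\sigma_i$ for every $1\le i\le\ell$, the function $x\mapsto k^Z_\mu(x,x)-k^Z_{s,\mu}(x,x)$ is $\mu$-integrable, and $$\int_{\mathcal X}\bigl(k^Z_\mu(x,x)-k^Z_{s,\mu}(x,x)\bigr)\,\mathrm d\mu(x)\le\sum_{i=s+1}^{\ell}\sigma_i .$$ -/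

import Mathlib

open MeasureTheory

namespace Nystrom

/-- `B` satisfies the four Penrose equations for the real matrix `A`. -/
structure IsMoorePenrose {m n : Type*} [Fintype m] [Fintype n]
    (A : Matrix m n ℝ) (B : Matrix n m ℝ) : Prop where
  mul_mul_left : A * B * A = A
  mul_mul_right : B * A * B = B
  symm_left : (A * B).transpose = A * B
  symm_right : (B * A).transpose = B * A

theorem exists_isMoorePenrose_of_isHermitian {n : Type*} [Fintype n]
    (A : Matrix n n ℝ) (hA : A.IsHermitian) : ∃ B, IsMoorePenrose A B := by
  classical
  let U : Matrix n n ℝ := hA.eigenvectorUnitary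
  let d : n → ℝ := hA.eigenvalues
  have hU : star U * U = 1 := Unitary.coe_star_mul_self hA.eigenvectorUnitary
  have hAs : A = U * Matrix.diagonal d * star U := by
    have h := hA.spectral_theorem
    rw [Unitary.conjStarAlgAut_apply] at h
    exact h
  have key : ∀ a b : n → ℝ, (U * Matrix.diagonal a * star U) * (U * Matrix.diagonal b * star U)
      = U * Matrix.diagonal (fun i => a i * b i) * star U := by
    intro a b
    calc _ = U * Matrix.diagonal a * (star U * U) * Matrix.diagonal b * star U := by
          simp only [Matrix.mul_assoc]
      _ = _ := by
          rw [hU, Matrix.mul_one, Matrix.mul_assoc U, Matrix.diagonal_mul_diagonal]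
  have tr : ∀ a : n → ℝ, (U * Matrix.diagonal a * star U).transpose
      = U * Matrix.diagonal a * star U := by
    intro a
    simp [Matrix.star_eq_conjTranspose, Matrix.conjTranspose_eq_transpose_of_trivial,
      Matrix.transpose_mul, Matrix.mul_assoc]
  refine ⟨U * Matrix.diagonal (fun i => (d i)⁻¹) * star U, ?_⟩
  rw [hAs]
  constructor
  · rw [key, key]; congr; ext i
    by_cases h : d i = 0 <;> simp [h]
  · rw [key, key]; congr; ext i
    by_cases h : d i = 0 <;> simp [h]
  · rw [key, tr]
  · rw [key, tr]

theorem exists_isMoorePenrose {m n : Type*} [Fintype m] [Fintype n] (A : Matrix m n ℝ) :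
    ∃ B, IsMoorePenrose A B := by
  classical
  have hG : (A.transpose * A).IsHermitian := by
    rw [Matrix.IsHermitian, Matrix.conjTranspose_eq_transpose_of_trivial,
      Matrix.transpose_mul, Matrix.transpose_transpose]
  obtain ⟨P, h1, h2, h3, h4⟩ := exists_isMoorePenrose_of_isHermitian _ hG
  have hGt : (A.transpose * A).transpose = A.transpose * A := by
    rw [Matrix.transpose_mul, Matrix.transpose_transpose]
  have hA : A * P * A.transpose * A = A := by
    have h0 : (A * P * A.transpose * A - A).transpose * (A * P * A.transpose * A - A) = 0 := by
      have e : A * P * A.transpose * A - A = A * (P * (A.transpose * A) - 1) := by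
        rw [Matrix.mul_sub, Matrix.mul_one]; simp only [Matrix.mul_assoc]
      have e2 : (A.transpose * A) * (P * (A.transpose * A) - 1) = 0 := by
        rw [Matrix.mul_sub, Matrix.mul_one, ← Matrix.mul_assoc, h1, sub_self]
      rw [e, Matrix.transpose_mul, Matrix.mul_assoc, ← Matrix.mul_assoc A.transpose, e2,
        Matrix.mul_zero]
    rw [← Matrix.conjTranspose_eq_transpose_of_trivial,
      Matrix.conjTranspose_mul_self_eq_zero] at h0
    exact sub_eq_zero.mp h0
  refine ⟨P * A.transpose, ?_, ?_, ?_, ?_⟩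
  · rw [← Matrix.mul_assoc]; exact hA
  · calc P * A.transpose * A * (P * A.transpose)
        = (P * (A.transpose * A) * P) * A.transpose := by simp only [Matrix.mul_assoc]
      _ = _ := by rw [h2]
  · have hPt : A * P.transpose * A.transpose * A = A := by
      have h5 : A.transpose * A * P * (A.transpose * A) = A.transpose * A := h1
      have h0 : (A * P.transpose * A.transpose * A - A).transpose *
          (A * P.transpose * A.transpose * A - A) = 0 := by
        have e : A * P.transpose * A.transpose * A - A
            = A * (P.transpose * (A.transpose * A) - 1) := by
          rw [Matrix.mul_sub, Matrix.mul_one]; simp only [Matrix.mul_assoc]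
        have h6 : A.transpose * A * (P.transpose * (A.transpose * A)) = A.transpose * A := by
          have := congrArg Matrix.transpose h5
          rwa [Matrix.transpose_mul (A.transpose * A * P), Matrix.transpose_mul _ P, hGt] at this
        have e2 : (A.transpose * A) * (P.transpose * (A.transpose * A) - 1) = 0 := by
          rw [Matrix.mul_sub, Matrix.mul_one, h6, sub_self]
        rw [e, Matrix.transpose_mul, Matrix.mul_assoc, ← Matrix.mul_assoc A.transpose, e2,
          Matrix.mul_zero]
      rw [← Matrix.conjTranspose_eq_transpose_of_trivial,
        Matrix.conjTranspose_mul_self_eq_zero] at h0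
      exact sub_eq_zero.mp h0
    have hPt' : A.transpose * A * P * A.transpose = A.transpose := by
      have := congrArg Matrix.transpose hPt
      simpa [Matrix.transpose_mul, Matrix.mul_assoc] using this
    calc (A * (P * A.transpose)).transpose = A * P.transpose * A.transpose := by
          simp [Matrix.transpose_mul, Matrix.mul_assoc]
      _ = A * P.transpose * (A.transpose * A * P * A.transpose) := by rw [hPt']
      _ = (A * P.transpose * A.transpose * A) * P * A.transpose := by
          simp only [Matrix.mul_assoc]
      _ = A * (P * A.transpose) := by rw [hPt, Matrix.mul_assoc]
  · rw [Matrix.mul_assoc]; exact h4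

/-- The Penrose equations have at most one solution. -/
theorem IsMoorePenrose.unique {m n : Type*} [Fintype m] [Fintype n] {A : Matrix m n ℝ}
    {B C : Matrix n m ℝ} (hB : IsMoorePenrose A B) (hC : IsMoorePenrose A C) : B = C := by
  have h1 : A * B = A * C := by
    calc A * B = (A * C * A) * B := by rw [hC.mul_mul_left]
      _ = (A * C) * (A * B) := by simp only [Matrix.mul_assoc]
      _ = (A * C).transpose * (A * B).transpose := by rw [hC.symm_left, hB.symm_left]
      _ = ((A * B * A) * C).transpose := by
          rw [← Matrix.transpose_mul]; simp only [Matrix.mul_assoc]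
      _ = A * C := by rw [hB.mul_mul_left, hC.symm_left]
  have h2 : B * A = C * A := by
    calc B * A = B * (A * C * A) := by rw [hC.mul_mul_left]
      _ = (B * A) * (C * A) := by simp only [Matrix.mul_assoc]
      _ = (B * A).transpose * (C * A).transpose := by rw [hC.symm_right, hB.symm_right]
      _ = (C * (A * B * A)).transpose := by
          rw [← Matrix.transpose_mul]; simp only [Matrix.mul_assoc]
      _ = C * A := by rw [hB.mul_mul_left, hC.symm_right]
  calc B = B * A * B := hB.mul_mul_right.symm
    _ = C * A * C := by rw [h2, Matrix.mul_assoc, h1, ← Matrix.mul_assoc]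
    _ = C := hC.mul_mul_right

/-- The Moore–Penrose pseudo-inverse `A⁺`: the unique solution of the four Penrose equations. -/
noncomputable def pinv {m n : Type*} [Fintype m] [Fintype n] (A : Matrix m n ℝ) :
    Matrix n m ℝ :=
  Classical.choose (exists_isMoorePenrose A)

theorem pinv_spec {m n : Type*} [Fintype m] [Fintype n] (A : Matrix m n ℝ) :
    IsMoorePenrose A (pinv A) :=
  Classical.choose_spec (exists_isMoorePenrose A)

/-- `k` is a kernel on the probability space `(X, μ)`: symmetric positive semi-definite
(all finite Gram matrices are positive semi-definite), jointly measurable,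
and with `∫ k(x, x) dμ(x) < ∞`. -/
structure IsKernel {X : Type*} [MeasurableSpace X] (μ : Measure X) (k : X → X → ℝ) : Prop where
  posSemidef : (Matrix.of k).PosSemidef
  measurable : Measurable (Function.uncurry k)
  integrable_diag : Integrable (fun x => k x x) μ

section Kernel

variable {X : Type*} [MeasurableSpace X] {μ : Measure X} {k : X → X → ℝ}

theorem IsKernel.diag_nonneg (hk : IsKernel μ k) (x : X) : 0 ≤ k x x :=
  hk.posSemidef.diag_nonneg (i := x)

theorem IsKernel.sq_le (hk : IsKernel μ k) (x y : X) : k x y ^ 2 ≤ k x x * k y y := by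
  have h := (hk.posSemidef.submatrix ![x, y])
  have hs : k y x = k x y := by simpa using hk.posSemidef.isHermitian.apply x y
  have hd := h.det_nonneg
  rw [Matrix.det_fin_two] at hd
  change 0 ≤ k x x * k y y - k x y * k y x at hd
  rw [hs] at hd
  nlinarith

theorem IsKernel.abs_le (hk : IsKernel μ k) (x y : X) : |k x y| ≤ √(k x x) * √(k y y) := by
  rw [← Real.sqrt_mul (hk.diag_nonneg x)]
  exact Real.abs_le_sqrt (hk.sq_le x y)

theorem IsKernel.measurable_diag (hk : IsKernel μ k) : Measurable (fun x => k x x) :=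
  hk.measurable.comp (measurable_id.prodMk measurable_id)

theorem IsKernel.memLp_sqrt (hk : IsKernel μ k) : MemLp (fun x => √(k x x)) 2 μ := by
  rw [memLp_two_iff_integrable_sq hk.measurable_diag.sqrt.aestronglyMeasurable]
  simpa only [Real.sq_sqrt (hk.diag_nonneg _)] using hk.integrable_diag

theorem IsKernel.memLp_section (hk : IsKernel μ k) (x : X) : MemLp (k x) 2 μ := by
  refine MemLp.mono (hk.memLp_sqrt.const_mul √(k x x))
    (hk.measurable.comp measurable_prodMk_left).aestronglyMeasurable (ae_of_all _ fun y => ?_)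
  rw [Real.norm_eq_abs, Real.norm_of_nonneg (by positivity)]
  exact hk.abs_le x y

theorem IsKernel.integrable_mul (hk : IsKernel μ k) (x : X) (f : Lp ℝ 2 μ) :
    Integrable (fun y => k x y * f y) μ :=
  (hk.memLp_section x).integrable_mul (Lp.memLp f)

theorem IsKernel.memLp_integral [SFinite μ] (hk : IsKernel μ k) (f : Lp ℝ 2 μ) :
    MemLp (fun x => ∫ y, k x y * f y ∂μ) 2 μ := by
  have hi : Integrable (fun y => √(k y y) * |f y|) μ :=
    hk.memLp_sqrt.integrable_mul (Lp.memLp f).abs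
  refine MemLp.mono (hk.memLp_sqrt.mul_const (∫ y, √(k y y) * |f y| ∂μ)) ?_
    (ae_of_all _ fun x => ?_)
  · refine StronglyMeasurable.aestronglyMeasurable ?_
    refine StronglyMeasurable.integral_prod_right (f := fun x y => k x y * f y) ?_
    exact (hk.measurable.mul
      ((Lp.stronglyMeasurable f).measurable.comp measurable_snd)).stronglyMeasurable
  · have hn : 0 ≤ ∫ y, √(k y y) * |f y| ∂μ := integral_nonneg fun y => by positivity
    rw [Real.norm_of_nonneg (mul_nonneg (Real.sqrt_nonneg _) hn), ← integral_const_mul]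
    refine (norm_integral_le_integral_norm _).trans ?_
    refine integral_mono (hk.integrable_mul x f).norm (hi.const_mul _) fun y => ?_
    rw [norm_mul, Real.norm_eq_abs, Real.norm_eq_abs, ← mul_assoc]
    exact mul_le_mul_of_nonneg_right (hk.abs_le x y) (abs_nonneg _)

/-- The integral operator `(𝒦 f)(x) = ∫ k(x, y) f(y) dμ(y)` on `L²(μ)`. -/
noncomputable def integralOperator [SFinite μ] (hk : IsKernel μ k) :
    Module.End ℝ (Lp ℝ 2 μ) where
  toFun f := (hk.memLp_integral f).toLp (fun x => ∫ y, k x y * f y ∂μ)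
  map_add' f g := by
    rw [← MemLp.toLp_add]
    refine MemLp.toLp_congr _ _ (ae_of_all _ fun x => ?_)
    simp only [Pi.add_apply]
    rw [← integral_add (hk.integrable_mul x f) (hk.integrable_mul x g)]
    refine integral_congr_ae ?_
    filter_upwards [Lp.coeFn_add f g] with y hy
    rw [hy, Pi.add_apply, mul_add]
  map_smul' c f := by
    rw [RingHom.id_apply, ← MemLp.toLp_const_smul]
    refine MemLp.toLp_congr _ _ (ae_of_all _ fun x => ?_)
    simp only [Pi.smul_apply, smul_eq_mul]
    rw [← integral_const_mul]
    refine integral_congr_ae ?_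
    filter_upwards [Lp.coeFn_smul c f] with y hy
    rw [hy, Pi.smul_apply, smul_eq_mul]
    ring

end Kernel

/-- `σ 0 ≥ σ 1 ≥ ⋯ ≥ 0` lists the positive eigenvalues of `T`, each one as often as the dimension
of its eigenspace; if there are only finitely many, the list continues with zeros. -/
structure IsEigenvalueSequence {E : Type*} [AddCommGroup E] [Module ℝ E] (T : Module.End ℝ E)
    (σ : ℕ → ℝ) : Prop where
  antitone : Antitone σ
  nonneg : ∀ i, 0 ≤ σ i
  encard_eq : ∀ t : ℝ, 0 < t →
    {i | σ i = t}.encard = (Module.rank ℝ (Module.End.eigenspace T t)).toENat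

variable {X : Type*} {ℓ : ℕ}

/-- The matrix `h(Z, Z) = (h(z_i, z_j))_{i,j}`. -/
def gram (h : X → X → ℝ) (Z : Fin ℓ → X) : Matrix (Fin ℓ) (Fin ℓ) ℝ :=
  Matrix.of fun i j => h (Z i) (Z j)

/-- `h_μ(x, y) = ∫ k(x, t) k(t, y) dμ(t)`. -/
noncomputable def squareKernel [MeasurableSpace X] (μ : Measure X) (k : X → X → ℝ) (x y : X) : ℝ :=
  ∫ t, k x t * k t y ∂μ

/-- `H` is a factor of `h_μ(Z, Z) = Hᵀ H`, and `H k(Z, Z)⁺ Hᵀ = V diag(κ) Vᵀ` with `V` orthogonal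
and `κ_1 ≥ ⋯ ≥ κ_ℓ ≥ 0`. -/
structure IsMercerData [MeasurableSpace X] (μ : Measure X) (k : X → X → ℝ) (Z : Fin ℓ → X)
    (H V : Matrix (Fin ℓ) (Fin ℓ) ℝ) (κ : Fin ℓ → ℝ) : Prop where
  factor : H.transpose * H = gram (squareKernel μ k) Z
  orthogonal : V ∈ Matrix.orthogonalGroup (Fin ℓ) ℝ
  antitone : Antitone κ
  nonneg : ∀ i, 0 ≤ κ i
  svd : H * pinv (gram k Z) * H.transpose = V * Matrix.diagonal κ * V.transpose

/-- `f_i = (H⁺ v_i)ᵀ k(Z, ·)`, where `v_i` is the `i`-th column of `V`. -/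
noncomputable def mercerFun (k : X → X → ℝ) (Z : Fin ℓ → X) (H V : Matrix (Fin ℓ) (Fin ℓ) ℝ)
    (i : Fin ℓ) (x : X) : ℝ :=
  dotProduct ((pinv H).mulVec (V.col i)) (fun j => k (Z j) x)

/-- `k^Z_μ(x, y) = ∑_{i=1}^ℓ κ_i f_i(x) f_i(y)`. -/
noncomputable def mercerKernel (k : X → X → ℝ) (Z : Fin ℓ → X) (H V : Matrix (Fin ℓ) (Fin ℓ) ℝ)
    (κ : Fin ℓ → ℝ) (x y : X) : ℝ :=
  ∑ i, κ i * mercerFun k Z H V i x * mercerFun k Z H V i y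

/-- `k^Z_{s,μ}(x, y) = ∑_{i=1}^s κ_i f_i(x) f_i(y)`. -/
noncomputable def truncatedMercerKernel (k : X → X → ℝ) (Z : Fin ℓ → X)
    (H V : Matrix (Fin ℓ) (Fin ℓ) ℝ) (κ : Fin ℓ → ℝ) (s : ℕ) (x y : X) : ℝ :=
  ∑ i with i.val < s, κ i * mercerFun k Z H V i x * mercerFun k Z H V i y

end Nystrom

/-! In the reproducing kernel Hilbert space of `k`, with feature map `φ`, the inclusion `ι` into
`L²(μ)` is Hilbert–Schmidt because `∫ k(x, x) dμ(x) < ∞`, and `𝒦 = ι ι*`. If `P` projects onto the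
span of the `φ (z_j)`, then `∑ κ_i ⟪f_i, f⟫² = ⟪ι P ι* f, f⟫ ≤ ⟪𝒦 f, f⟫`, and the `f_i` with
`κ_i ≠ 0` are orthonormal in `L²(μ)`. The min-max principle on the span of `f_1, …, f_i` gives
`κ_i ≤ σ_i`, and integrating the tail of the Mercer sum gives `∑_{i > s} κ_i`. -/

namespace Nystrom

section HilbertSchmidt

variable {𝕜 E F : Type*} [RCLike 𝕜] [NormedAddCommGroup E] [InnerProductSpace 𝕜 E]
  [NormedAddCommGroup F] [NormedSpace 𝕜 F] {T : E →L[𝕜] F}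

/-- Hilbert–Schmidt operators, through uniformly bounded sums over finite orthonormal families, so
that no orthonormal basis of `E` has to be chosen. -/
def IsHilbertSchmidt (T : E →L[𝕜] F) : Prop :=
  ∃ C : ℝ, ∀ (n : ℕ) (v : Fin n → E), Orthonormal 𝕜 v → ∑ i, ‖T (v i)‖ ^ 2 ≤ C

theorem IsHilbertSchmidt.exists_orthonormal_norm_le (hT : IsHilbertSchmidt T) {ε : ℝ}
    (hε : 0 < ε) : ∃ (n : ℕ) (v : Fin n → E), Orthonormal 𝕜 v ∧
      ∀ x, (∀ i, inner 𝕜 (v i) x = 0) → ‖T x‖ ≤ ε * ‖x‖ := by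
  obtain ⟨C, hC⟩ := hT
  let A : Set ℝ := {r | ∃ (n : ℕ) (v : Fin n → E), Orthonormal 𝕜 v ∧ ∑ i, ‖T (v i)‖ ^ 2 = r}
  have hA : A.Nonempty := ⟨0, 0, Fin.elim0, ⟨fun i => i.elim0, fun i => i.elim0⟩, by simp⟩
  have hAb : BddAbove A := ⟨C, by rintro _ ⟨n, v, hv, rfl⟩; exact hC n v hv⟩
  -- A family that almost maximizes the sum of squares cannot be extended by a vector with large
  -- image.
  obtain ⟨_, ⟨n, v, hv, rfl⟩, hlt⟩ :=
    exists_lt_of_lt_csSup hA (sub_lt_self (sSup A) (pow_pos hε 2))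
  refine ⟨n, v, hv, fun x hx => ?_⟩
  rcases eq_or_ne x 0 with rfl | hx0
  · simp
  let u : E := (‖x‖⁻¹ : 𝕜) • x
  have hu : Orthonormal 𝕜 (Matrix.vecCons u v) := by
    refine orthonormal_vecCons_iff.2 ⟨norm_smul_inv_norm hx0, fun i => ?_, hv⟩
    rw [inner_smul_left, inner_eq_zero_symm.1 (hx i), mul_zero]
  have hle : ‖T u‖ ^ 2 + ∑ i, ‖T (v i)‖ ^ 2 ≤ sSup A :=
    le_csSup hAb ⟨n + 1, _, hu, by simp [Fin.sum_univ_succ]⟩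
  have hTu : ‖T u‖ ≤ ε := (pow_le_pow_iff_left₀ (norm_nonneg _) hε.le two_ne_zero).1 (by linarith)
  rwa [map_smul, norm_smul, norm_inv, RCLike.norm_ofReal, abs_norm,
    inv_mul_le_iff₀' (norm_pos_iff.2 hx0)] at hTu

theorem IsHilbertSchmidt.isCompactOperator [CompleteSpace F] (hT : IsHilbertSchmidt T) :
    IsCompactOperator T := by
  have hclosed : IsClosed {f : E →L[𝕜] F | IsCompactOperator f} :=
    isClosed_setOfPred_isCompactOperator
  refine hclosed.closure_subset (Metric.mem_closure_iff.2 fun ε hε => ?_)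
  obtain ⟨n, v, -, h⟩ := hT.exists_orthonormal_norm_le (half_pos hε)
  let S : Submodule 𝕜 E := Submodule.span 𝕜 (Set.range v)
  have : FiniteDimensional 𝕜 S := FiniteDimensional.span_of_finite 𝕜 (Set.finite_range v)
  have : ProperSpace S := FiniteDimensional.proper 𝕜 S
  refine ⟨(T ∘L S.subtypeL) ∘L S.orthogonalProjectionOnto,
    (isCompactOperator_of_locallyCompactSpace_dom S.orthogonalProjectionOnto).clm_comp
      (T ∘L S.subtypeL), ?_⟩
  rw [dist_eq_norm]
  refine (ContinuousLinearMap.opNorm_le_bound _ (half_pos hε).le fun x => ?_).trans_lt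
    (half_lt_self hε)
  have hx : x - S.starProjection x ∈ Sᗮ := S.sub_starProjection_mem_orthogonal x
  have hnorm : ‖x - S.starProjection x‖ ≤ ‖x‖ := by
    rw [← Submodule.starProjection_orthogonal_val]
    exact Sᗮ.norm_starProjection_apply_le x
  calc ‖(T - (T ∘L S.subtypeL) ∘L S.orthogonalProjectionOnto) x‖
      = ‖T (x - S.starProjection x)‖ := by simp
    _ ≤ ε / 2 * ‖x - S.starProjection x‖ :=
        h _ fun i => (Submodule.mem_orthogonal _ _).1 hx _ (Submodule.subset_span ⟨i, rfl⟩)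
    _ ≤ ε / 2 * ‖x‖ := mul_le_mul_of_nonneg_left hnorm (half_pos hε).le

end HilbertSchmidt

section MinMax

theorem opNorm_le_of_hasEigenvalue_norm_le {𝕜 E : Type*} [RCLike 𝕜] [NormedAddCommGroup E]
    [InnerProductSpace 𝕜 E] [CompleteSpace E] {T : E →L[𝕜] E} (hc : IsCompactOperator T)
    (hs : IsSelfAdjoint T) {c : ℝ} (hc0 : 0 ≤ c)
    (h : ∀ t, Module.End.HasEigenvalue (T : Module.End 𝕜 E) t → ‖t‖ ≤ c) : ‖T‖ ≤ c := by
  have hr : spectralRadius 𝕜 T ≤ ENNReal.ofReal c := iSup₂_le fun t ht => by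
    rcases eq_or_ne t 0 with rfl | ht0
    · simp
    · rw [← enorm_eq_nnnorm, ← ofReal_norm]
      exact ENNReal.ofReal_le_ofReal (h t ((hc.hasEigenvalue_iff_mem_spectrum ht0).2 ht))
  rwa [T.spectralRadius_eq_nnnorm hs, ← enorm_eq_nnnorm, ← ofReal_norm,
    ENNReal.ofReal_le_ofReal_iff hc0] at hr

theorem exists_le_span_image_of_encard_eq {K M ι : Type*} [DivisionRing K] [AddCommGroup M]
    [Module K M] {N : Submodule K M} {S : Set ι} (hS : S.Finite)
    (h : S.encard = (Module.rank K N).toENat) :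
    ∃ b : ι → M, N ≤ Submodule.span K (b '' S) := by
  have : Finite S := hS
  have : Module.Finite K N := by
    rw [← Module.rank_lt_aleph0_iff, ← Cardinal.toENat_lt_top, ← h]
    exact hS.encard_lt_top
  have hcard : Nat.card S = Module.finrank K N := by
    rw [← Module.finrank_eq_rank, Cardinal.toENat_nat, ← hS.cast_ncard_eq] at h
    exact_mod_cast h
  let e : S ≃ Fin (Module.finrank K N) := Finite.equivFinOfCardEq hcard
  let f : S → M := fun i => Module.finBasis K N (e i)
  refine ⟨Function.extend Subtype.val f 0, ?_⟩
  have himage : Function.extend Subtype.val f 0 '' S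
      = N.subtype '' Set.range (Module.finBasis K N) := by
    rw [← Set.range_comp, ← e.surjective.range_comp, Set.image_eq_range]
    exact congrArg Set.range (funext fun i => Subtype.val_injective.extend_apply f 0 i)
  rw [himage, Submodule.span_image, Module.Basis.span_eq, Submodule.map_top,
    Submodule.range_subtype]

theorem IsEigenvalueSequence.exists_eigenspace_le_span {E : Type*} [AddCommGroup E] [Module ℝ E]
    {T : Module.End ℝ E} {σ : ℕ → ℝ} (hσ : IsEigenvalueSequence T σ) (n : ℕ) :
    ∃ v : Fin n → E, ∀ t, σ n < t → T.eigenspace t ≤ Submodule.span ℝ (Set.range v) := by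
  have hlt : ∀ t, σ n < t → {i | σ i = t} ⊆ Set.Iio n := by
    rintro _ ht i rfl
    by_contra! hni
    exact ht.not_ge (hσ.antitone (not_lt.1 hni))
  choose! b hb using fun t (ht : σ n < t) => exists_le_span_image_of_encard_eq
    ((Set.finite_Iio n).subset (hlt t ht)) (hσ.encard_eq t ((hσ.nonneg n).trans_lt ht))
  refine ⟨fun i => b (σ i) i, fun t ht => (hb t ht).trans (Submodule.span_mono ?_)⟩
  rintro _ ⟨i, rfl, rfl⟩
  exact ⟨⟨i, hlt _ ht rfl⟩, rfl⟩

theorem exists_mem_ne_zero_inner_eq_zero {𝕜 E : Type*} [RCLike 𝕜] [NormedAddCommGroup E]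
    [InnerProductSpace 𝕜 E] {n : ℕ} (W : Submodule 𝕜 E) [FiniteDimensional 𝕜 W]
    (hn : n < Module.finrank 𝕜 W) (v : Fin n → E) :
    ∃ w ∈ W, w ≠ 0 ∧ ∀ u ∈ Submodule.span 𝕜 (Set.range v), inner 𝕜 u w = 0 := by
  let f : W →ₗ[𝕜] Fin n → 𝕜 := LinearMap.pi fun i => (innerₛₗ 𝕜 (v i)) ∘ₗ W.subtype
  obtain ⟨w, hw, hw0⟩ := Submodule.exists_mem_ne_zero_of_ne_bot
    (LinearMap.ker_ne_bot_of_finrank_lt (f := f) (by simpa using hn))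
  refine ⟨w, w.2, by simpa using hw0, fun u hu => ?_⟩
  induction hu using Submodule.span_induction with
  | mem _ hu => obtain ⟨i, rfl⟩ := hu; exact congrFun hw i
  | zero => exact inner_zero_left _
  | add u u' _ _ hu hu' => rw [inner_add_left, hu, hu', add_zero]
  | smul c u _ hu => rw [inner_smul_left, hu, mul_zero]

variable {E : Type*} [NormedAddCommGroup E] [InnerProductSpace ℝ E]

theorem inner_map_self_le_of_mem_orthogonal_eigenspaces [CompleteSpace E] {T : E →L[ℝ] E}
    (hc : IsCompactOperator T) (hT : T.IsPositive) {c : ℝ} (hc0 : 0 ≤ c) {x : E}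
    (hx : x ∈ (⨆ t > c, Module.End.eigenspace (T : Module.End ℝ E) t)ᗮ) :
    inner ℝ (T x) x ≤ c * ‖x‖ ^ 2 := by
  set U : Submodule ℝ E := ⨆ t > c, Module.End.eigenspace (T : Module.End ℝ E) t
  have hU : U ∈ Module.End.invtSubmodule (T : Module.End ℝ E) := by
    refine (Module.End.mem_invtSubmodule _).2 (iSup₂_le fun t ht y hy => ?_)
    rw [Submodule.mem_comap, Module.End.mem_eigenspace_iff.1 hy]
    exact U.smul_mem t (Submodule.mem_iSup_of_mem t (Submodule.mem_iSup_of_mem ht hy))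
  have hinv : ∀ y ∈ Uᗮ, (T : E →ₗ[ℝ] E) y ∈ Uᗮ :=
    hT.isSymmetric.orthogonalComplement_mem_invtSubmodule hU
  let S : Uᗮ →L[ℝ] Uᗮ := T.restrict hinv
  have hS : ‖S‖ ≤ c := by
    have hSsa : IsSelfAdjoint S := ContinuousLinearMap.isSelfAdjoint_iff_isSymmetric.2
      (hT.isSymmetric.restrict_invariant hinv)
    refine opNorm_le_of_hasEigenvalue_norm_le (hc.restrict' hinv) hSsa hc0 fun t ht => ?_
    obtain ⟨y, hy⟩ := ht.exists_hasEigenvector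
    have hTy : T (y : E) = t • (y : E) := congrArg Subtype.val hy.apply_eq_smul
    have hy0 : (y : E) ≠ 0 := by simpa using hy.2
    have ht0 : 0 ≤ t := eigenvalue_nonneg_of_nonneg (𝕜 := ℝ) ht fun y =>
      hT.inner_nonneg_right (y : E)
    rw [Real.norm_of_nonneg ht0]
    by_contra! hlt
    have hyU : (y : E) ∈ U := Submodule.mem_iSup_of_mem t
      (Submodule.mem_iSup_of_mem hlt (Module.End.mem_eigenspace_iff.2 hTy))
    exact hy0 (inner_self_eq_zero.1 ((Submodule.mem_orthogonal _ _).1 y.2 _ hyU))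
  calc inner ℝ (T x) x ≤ ‖S ⟨x, hx⟩‖ * ‖x‖ := real_inner_le_norm _ _
    _ ≤ c * ‖x‖ * ‖x‖ := mul_le_mul_of_nonneg_right (S.le_of_opNorm_le hS ⟨x, hx⟩) (norm_nonneg x)
    _ = c * ‖x‖ ^ 2 := by ring

theorem IsEigenvalueSequence.le_of_finrank_lt [CompleteSpace E] {T : E →L[ℝ] E}
    {σ : ℕ → ℝ} (hσ : IsEigenvalueSequence (T : Module.End ℝ E) σ)
    (hc : IsCompactOperator T) (hT : T.IsPositive) {n : ℕ} {c : ℝ}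
    (W : Submodule ℝ E) [FiniteDimensional ℝ W] (hn : n < Module.finrank ℝ W)
    (hW : ∀ w ∈ W, c * ‖w‖ ^ 2 ≤ inner ℝ (T w) w) : c ≤ σ n := by
  obtain ⟨v, hv⟩ := hσ.exists_eigenspace_le_span n
  obtain ⟨w, hwW, hw0, hwv⟩ := exists_mem_ne_zero_inner_eq_zero W hn v
  have hw : w ∈ (⨆ t > σ n, Module.End.eigenspace (T : Module.End ℝ E) t)ᗮ :=
    (Submodule.mem_orthogonal _ _).2 fun u hu => hwv u (iSup₂_le hv hu)
  exact le_of_mul_le_mul_right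
    ((hW w hwW).trans (inner_map_self_le_of_mem_orthogonal_eigenspaces hc hT (hσ.nonneg n) hw))
    (pow_pos (norm_pos_iff.2 hw0) 2)

theorem norm_sq_eq_sum_inner_sq_of_mem_span {ι : Type*} [Fintype ι] {v : ι → E}
    (hv : Orthonormal ℝ v) {w : E} (hw : w ∈ Submodule.span ℝ (Set.range v)) :
    ‖w‖ ^ 2 = ∑ i, inner ℝ (v i) w ^ 2 := by
  obtain ⟨c, rfl⟩ := (Submodule.mem_span_range_iff_exists_fun ℝ).1 hw
  rw [← real_inner_self_eq_norm_sq, hv.inner_sum]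
  simp only [hv.inner_right_fintype, conj_trivial, sq]

theorem IsEigenvalueSequence.le_of_sum_mul_inner_sq_le [CompleteSpace E] {T : E →L[ℝ] E}
    {σ : ℕ → ℝ} (hσ : IsEigenvalueSequence (T : Module.End ℝ E) σ)
    (hc : IsCompactOperator T) (hT : T.IsPositive) {ℓ : ℕ} {κ : Fin ℓ → ℝ} (hκ : Antitone κ)
    (hκ0 : ∀ i, 0 ≤ κ i) {e : Fin ℓ → E} (he : Orthonormal ℝ fun i : {i // κ i ≠ 0} => e i)
    (hle : ∀ f, ∑ i, κ i * inner ℝ (e i) f ^ 2 ≤ inner ℝ (T f) f) (i : Fin ℓ) : κ i ≤ σ i := by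
  rcases (hκ0 i).eq_or_lt with hi | hi
  · exact hi ▸ hσ.nonneg i
  have hv : Orthonormal ℝ fun j : Finset.Iic i => e j :=
    he.comp (fun j : Finset.Iic i => ⟨j.1, (hi.trans_le (hκ (Finset.mem_Iic.1 j.2))).ne'⟩)
      fun j j' h => Subtype.ext (Subtype.mk.inj h)
  let W : Submodule ℝ E := Submodule.span ℝ (Set.range fun j : Finset.Iic i => e j)
  have : FiniteDimensional ℝ W := FiniteDimensional.span_of_finite ℝ (Set.finite_range _)
  have hdim : Module.finrank ℝ W = i + 1 := by
    rw [finrank_span_eq_card hv.linearIndependent, Fintype.card_coe, Fin.card_Iic]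
  refine hσ.le_of_finrank_lt hc hT W (hdim ▸ Nat.lt_succ_self i) fun w hw => ?_
  calc κ i * ‖w‖ ^ 2 = ∑ j ∈ Finset.Iic i, κ i * inner ℝ (e j) w ^ 2 := by
        rw [norm_sq_eq_sum_inner_sq_of_mem_span hv hw, Finset.mul_sum,
          Finset.sum_coe_sort (Finset.Iic i) fun j => κ i * inner ℝ (e j) w ^ 2]
    _ ≤ ∑ j ∈ Finset.Iic i, κ j * inner ℝ (e j) w ^ 2 := Finset.sum_le_sum fun j hj =>
        mul_le_mul_of_nonneg_right (hκ (Finset.mem_Iic.1 hj)) (sq_nonneg _)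
    _ ≤ ∑ j, κ j * inner ℝ (e j) w ^ 2 :=
        Finset.sum_le_univ_sum_of_nonneg fun j => mul_nonneg (hκ0 j) (sq_nonneg _)
    _ ≤ inner ℝ (T w) w := hle w

end MinMax

section PseudoInverse

open Matrix

theorem pinv_transpose {m n : Type*} [Fintype m] [Fintype n] (A : Matrix m n ℝ) :
    pinv Aᵀ = (pinv A)ᵀ := by
  refine (pinv_spec Aᵀ).unique ⟨?_, ?_, ?_, ?_⟩
  · simpa only [transpose_mul, Matrix.mul_assoc] using
      congrArg transpose (pinv_spec A).mul_mul_left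
  · simpa only [transpose_mul, Matrix.mul_assoc] using
      congrArg transpose (pinv_spec A).mul_mul_right
  · rw [← transpose_mul, (pinv_spec A).symm_right, (pinv_spec A).symm_right]
  · rw [← transpose_mul, (pinv_spec A).symm_left, (pinv_spec A).symm_left]

theorem transpose_mul_self_mul_pinv {m n : Type*} [Fintype m] [Fintype n] (A : Matrix m n ℝ) :
    Aᵀ * A * pinv A = Aᵀ := by
  rw [Matrix.mul_assoc, ← (pinv_spec A).symm_left, ← transpose_mul, (pinv_spec A).mul_mul_left]

variable {E ι : Type*} [NormedAddCommGroup E] [InnerProductSpace ℝ E] [Fintype ι]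

theorem dotProduct_gram_mulVec (v : ι → E) (a b : ι → ℝ) :
    a ⬝ᵥ Matrix.gram ℝ v *ᵥ b = inner ℝ (∑ i, a i • v i) (∑ i, b i • v i) := by
  simpa using star_dotProduct_gram_mulVec v a b

theorem dotProduct_pinv_gram_mulVec_le (u : ι → E) (g : E) :
    (fun i => inner ℝ (u i) g) ⬝ᵥ pinv (Matrix.gram ℝ u) *ᵥ (fun i => inner ℝ (u i) g)
      ≤ ‖g‖ ^ 2 := by
  set b : ι → ℝ := fun i => inner ℝ (u i) g
  set a : ι → ℝ := pinv (Matrix.gram ℝ u) *ᵥ b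
  let p : E := ∑ i, a i • u i
  have hG : (Matrix.gram ℝ u)ᵀ = Matrix.gram ℝ u := isHermitian_gram ℝ u
  have hgp : inner ℝ g p = b ⬝ᵥ a := by
    simp only [p, b, inner_sum, inner_smul_right, dotProduct, real_inner_comm, mul_comm]
  have hpp : inner ℝ p p = b ⬝ᵥ a := by
    rw [← dotProduct_gram_mulVec, mulVec_mulVec, dotProduct_mulVec, vecMul_mulVec,
      ← dotProduct_mulVec, ← pinv_transpose, hG, ← Matrix.mul_assoc, (pinv_spec _).mul_mul_right]
  have hsq : 0 ≤ ‖g - p‖ ^ 2 := sq_nonneg _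
  rw [norm_sub_sq_real, hgp, ← real_inner_self_eq_norm_sq p, hpp] at hsq
  linarith

theorem pinv_mul_self_mulVec_inner {m : Type*} [Fintype m] {w : ι → E} {H : Matrix m ι ℝ}
    (hH : Hᵀ * H = Matrix.gram ℝ w) (f : E) :
    (pinv H * H) *ᵥ (fun i => inner ℝ (w i) f) = fun i => inner ℝ (w i) f := by
  set x : ι → ℝ := fun i => inner ℝ (w i) f
  set P : Matrix ι ι ℝ := pinv H * H
  have hPt : Pᵀ = P := (pinv_spec H).symm_right
  have hPP : P * P = P := by rw [← Matrix.mul_assoc, (pinv_spec H).mul_mul_right]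
  have hHP : H * P = H := by rw [← Matrix.mul_assoc, (pinv_spec H).mul_mul_left]
  set d : ι → ℝ := x - P *ᵥ x
  have hGd : Matrix.gram ℝ w *ᵥ d = 0 := by
    rw [← hH, mulVec_sub, mulVec_mulVec, Matrix.mul_assoc, hHP, sub_self]
  have hdw : ∑ i, d i • w i = 0 := by
    rw [← inner_self_eq_zero (𝕜 := ℝ), ← dotProduct_gram_mulVec, hGd, dotProduct_zero]
  have hdx : d ⬝ᵥ x = 0 := calc
    d ⬝ᵥ x = inner ℝ (∑ i, d i • w i) f := by
      simp only [dotProduct, x, sum_inner, inner_smul_left, conj_trivial]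
    _ = 0 := by rw [hdw, inner_zero_left]
  have hdP : d ⬝ᵥ P *ᵥ x = 0 := by
    rw [dotProduct_mulVec, ← mulVec_transpose, hPt, mulVec_sub, mulVec_mulVec, hPP, sub_self,
      zero_dotProduct]
  have hd : d = 0 := dotProduct_self_eq_zero.1 (by
    rw [show d ⬝ᵥ d = d ⬝ᵥ x - d ⬝ᵥ P *ᵥ x from dotProduct_sub _ _ _, hdx, hdP, sub_zero])
  exact (sub_eq_zero.1 hd).symm

end PseudoInverse

section MercerVector

open Matrix

variable {E ι m : Type*} [NormedAddCommGroup E] [InnerProductSpace ℝ E] [Fintype ι] [Fintype m]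
  {w : ι → E} {H : Matrix m ι ℝ} {V : Matrix m m ℝ}

/-- The Mercer functions in an abstract Hilbert space: the combinations of the vectors `w j` whose
coefficients are the columns of `H⁺ V`. -/
noncomputable def mercerVector (w : ι → E) (H : Matrix m ι ℝ) (V : Matrix m m ℝ) (i : m) : E :=
  ∑ j, (pinv H * V) j i • w j

theorem inner_mercerVector (i : m) (f : E) :
    inner ℝ (mercerVector w H V i) f = ((pinv H * V)ᵀ *ᵥ fun j => inner ℝ (w j) f) i := by
  simp only [mercerVector, sum_inner, inner_smul_left, conj_trivial, mulVec, dotProduct,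
    transpose_apply]

theorem gram_mercerVector (hH : Hᵀ * H = Matrix.gram ℝ w) :
    Matrix.gram ℝ (mercerVector w H V) = Vᵀ * (H * pinv H) * V := by
  have hgram : Matrix.gram ℝ (mercerVector w H V)
      = (pinv H * V)ᵀ * Matrix.gram ℝ w * (pinv H * V) := by
    ext i j
    rw [Matrix.mul_assoc]
    exact (dotProduct_gram_mulVec w ((pinv H * V).col i) ((pinv H * V).col j)).symm
  calc Matrix.gram ℝ (mercerVector w H V)
      = Vᵀ * (pinv H)ᵀ * (Hᵀ * H * pinv H) * V := by
        rw [hgram, ← hH, transpose_mul]; simp only [Matrix.mul_assoc]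
    _ = Vᵀ * (H * pinv H)ᵀ * V := by
        rw [transpose_mul_self_mul_pinv, transpose_mul]; simp only [Matrix.mul_assoc]
    _ = Vᵀ * (H * pinv H) * V := by rw [(pinv_spec H).symm_left]

theorem map_mercerVector {F : Type*} [NormedAddCommGroup F] [InnerProductSpace ℝ F] (A : E →L[ℝ] F)
    (w : ι → E) (H : Matrix m ι ℝ) (V : Matrix m m ℝ) (i : m) :
    A (mercerVector w H V i) = mercerVector (fun j => A (w j)) H V i := by
  simp only [mercerVector, map_sum, map_smul]

variable [DecidableEq m] {P : Matrix ι ι ℝ} {κ : m → ℝ}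

theorem sum_mul_inner_mercerVector_sq (hH : Hᵀ * H = Matrix.gram ℝ w)
    (hsvd : H * P * Hᵀ = V * diagonal κ * Vᵀ) (f : E) :
    ∑ i, κ i * inner ℝ (mercerVector w H V i) f ^ 2
      = (fun j => inner ℝ (w j) f) ⬝ᵥ P *ᵥ fun j => inner ℝ (w j) f := by
  set x : ι → ℝ := fun j => inner ℝ (w j) f
  set A : Matrix ι m ℝ := pinv H * V
  have hA : A * diagonal κ * Aᵀ = pinv H * H * P * (pinv H * H)ᵀ := calc
    A * diagonal κ * Aᵀ = pinv H * (V * diagonal κ * Vᵀ) * (pinv H)ᵀ := by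
      simp only [A, transpose_mul, Matrix.mul_assoc]
    _ = pinv H * H * P * (pinv H * H)ᵀ := by
      rw [← hsvd, transpose_mul]; simp only [Matrix.mul_assoc]
  calc ∑ i, κ i * inner ℝ (mercerVector w H V i) f ^ 2
      = Aᵀ *ᵥ x ⬝ᵥ diagonal κ *ᵥ Aᵀ *ᵥ x := by
        simp only [dotProduct, mulVec_diagonal, inner_mercerVector, A, x]
        exact Finset.sum_congr rfl fun i _ => by ring
    _ = x ⬝ᵥ (A * diagonal κ * Aᵀ) *ᵥ x := by
        rw [mulVec_transpose, ← dotProduct_mulVec, ← mulVec_transpose, mulVec_mulVec, mulVec_mulVec]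
    _ = ((pinv H * H) *ᵥ x) ⬝ᵥ P *ᵥ (pinv H * H) *ᵥ x := by
        rw [hA, ← mulVec_mulVec, ← mulVec_mulVec, dotProduct_mulVec x, ← mulVec_transpose,
          (pinv_spec H).symm_right]
    _ = x ⬝ᵥ P *ᵥ x := by rw [pinv_mul_self_mulVec_inner hH f]

theorem inner_mercerVector_mul (hH : Hᵀ * H = Matrix.gram ℝ w) (hV : V ∈ orthogonalGroup m ℝ)
    (hsvd : H * P * Hᵀ = V * diagonal κ * Vᵀ) (i j : m) :
    inner ℝ (mercerVector w H V i) (mercerVector w H V j) * κ j = diagonal κ i j := by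
  have hVV : Vᵀ * V = 1 := (mem_orthogonalGroup_iff' m ℝ).1 hV
  have hVκ : V * diagonal κ = H * P * Hᵀ * V := by
    rw [hsvd, Matrix.mul_assoc, hVV, Matrix.mul_one]
  have hgram : Matrix.gram ℝ (mercerVector w H V) * diagonal κ = diagonal κ := calc
    Matrix.gram ℝ (mercerVector w H V) * diagonal κ = Vᵀ * (H * pinv H * H) * P * Hᵀ * V := by
      rw [gram_mercerVector hH, Matrix.mul_assoc _ V, hVκ]; simp only [Matrix.mul_assoc]
    _ = Vᵀ * (V * diagonal κ) := by
      rw [(pinv_spec H).mul_mul_left, hVκ]; simp only [Matrix.mul_assoc]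
    _ = diagonal κ := by rw [← Matrix.mul_assoc, hVV, Matrix.one_mul]
  simpa only [mul_diagonal, gram_apply] using congrFun₂ hgram i j

theorem orthonormal_mercerVector (hH : Hᵀ * H = Matrix.gram ℝ w) (hV : V ∈ orthogonalGroup m ℝ)
    (hsvd : H * P * Hᵀ = V * diagonal κ * Vᵀ) :
    Orthonormal ℝ fun i : {i // κ i ≠ 0} => mercerVector w H V i := by
  refine orthonormal_iff_ite.2 fun i j => mul_right_cancel₀ j.2 ?_
  rw [inner_mercerVector_mul hH hV hsvd, diagonal_apply]
  simp only [Subtype.ext_iff, ite_mul, one_mul, zero_mul]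
  split_ifs with hij
  · rw [hij]
  · rfl

theorem mul_norm_mercerVector_sq (hH : Hᵀ * H = Matrix.gram ℝ w) (hV : V ∈ orthogonalGroup m ℝ)
    (hsvd : H * P * Hᵀ = V * diagonal κ * Vᵀ) (i : m) :
    κ i * ‖mercerVector w H V i‖ ^ 2 = κ i := by
  rw [mul_comm, ← real_inner_self_eq_norm_sq, inner_mercerVector_mul hH hV hsvd, diagonal_apply_eq]

end MercerVector

section Compression

open ContinuousLinearMap Matrix

variable {E F : Type*} [NormedAddCommGroup E] [InnerProductSpace ℝ E] [CompleteSpace E]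
  [NormedAddCommGroup F] [InnerProductSpace ℝ F] [CompleteSpace F] {A : F →L[ℝ] E}

theorem sum_mul_inner_mercerVector_sq_le {ι m : Type*} [Fintype ι] [Fintype m] [DecidableEq m]
    {u : ι → F} {H : Matrix m ι ℝ} {V : Matrix m m ℝ} {κ : m → ℝ}
    (hH : Hᵀ * H = Matrix.gram ℝ fun j => A (u j))
    (hsvd : H * pinv (Matrix.gram ℝ u) * Hᵀ = V * diagonal κ * Vᵀ) (f : E) :
    ∑ i, κ i * inner ℝ (mercerVector (fun j => A (u j)) H V i) f ^ 2
      ≤ inner ℝ ((A ∘L adjoint A) f) f := by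
  rw [sum_mul_inner_mercerVector_sq hH hsvd, ContinuousLinearMap.comp_apply, ← adjoint_inner_right,
    real_inner_self_eq_norm_sq]
  simpa only [adjoint_inner_right] using dotProduct_pinv_gram_mulVec_le u (adjoint A f)

theorem IsEigenvalueSequence.le_of_mercerVector {σ : ℕ → ℝ}
    (hσ : IsEigenvalueSequence ((A ∘L adjoint A : E →L[ℝ] E) : Module.End ℝ E) σ)
    (hA : IsCompactOperator A) {ℓ : ℕ} {u : Fin ℓ → F} {H V : Matrix (Fin ℓ) (Fin ℓ) ℝ}
    {κ : Fin ℓ → ℝ} (hH : Hᵀ * H = Matrix.gram ℝ fun j => A (u j))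
    (hV : V ∈ orthogonalGroup (Fin ℓ) ℝ) (hκ : Antitone κ) (hκ0 : ∀ i, 0 ≤ κ i)
    (hsvd : H * pinv (Matrix.gram ℝ u) * Hᵀ = V * diagonal κ * Vᵀ) (i : Fin ℓ) : κ i ≤ σ i :=
  hσ.le_of_sum_mul_inner_sq_le (hA.comp_clm (adjoint A)) (isPositive_self_comp_adjoint A) hκ hκ0
    (orthonormal_mercerVector hH hV hsvd) (sum_mul_inner_mercerVector_sq_le hH hsvd) i

end Compression

section FeatureMap

universe u

/-- `φ` is a feature map of the kernel `k`: `k` is its Gram kernel, and its values span a dense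
subspace, so that `F` is the reproducing kernel Hilbert space of `k`, with `g` standing for the
function `x ↦ ⟪φ x, g⟫`. -/
structure IsFeatureMap {X F : Type*} [NormedAddCommGroup F] [InnerProductSpace ℝ F]
    (k : X → X → ℝ) (φ : X → F) : Prop where
  inner_eq : ∀ x y, inner ℝ (φ x) (φ y) = k x y
  dense_span : Dense (Submodule.span ℝ (Set.range φ) : Set F)

theorem exists_isFeatureMap {X : Type u} {k : X → X → ℝ} (hk : (Matrix.of k).PosSemidef) :
    ∃ (F : Type u) (_ : NormedAddCommGroup F) (_ : InnerProductSpace ℝ F) (_ : CompleteSpace F)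
      (φ : X → F), IsFeatureMap k φ := by
  have hsymm : ∀ x y, k y x = k x y := fun x y => by simpa using hk.isHermitian.apply x y
  -- The reproducing kernels of Mathlib are operator valued.
  let K : Matrix X X (ℝ →L[ℝ] ℝ) := .of fun x y => k x y • (1 : ℝ →L[ℝ] ℝ)
  have hK : K.PosSemidef := by
    have htfae := (RKHS.posSemidef_tfae (K := K)).out 0 2
    refine htfae.2 ⟨?_, fun v => ?_⟩
    · ext x y
      simp [K, hsymm]
    · have h := hk.2 v
      rw [Finsupp.sum_comm] at h
      simpa [K, mul_comm, mul_left_comm, mul_assoc] using h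
  have : Fact K.PosSemidef := ⟨hK⟩
  let φ : X → RKHS.OfKernel K := fun x => RKHS.kerFun (RKHS.OfKernel K) x 1
  refine ⟨RKHS.OfKernel K, inferInstance, inferInstance, inferInstance, φ, fun x y => ?_, ?_⟩
  · rw [← RKHS.kernel_inner, RKHS.OfKernel.kernel_ofKernel]
    simp [K, hsymm]
  · rw [Submodule.dense_iff_topologicalClosure_eq_top, ← top_le_iff,
      ← RKHS.kerFun_dense (RKHS.OfKernel K)]
    refine Submodule.topologicalClosure_mono (Submodule.span_le.2 ?_)
    rintro _ ⟨x, r, rfl⟩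
    have hr : RKHS.kerFun (RKHS.OfKernel K) x r = r • φ x := by
      rw [← map_smul, smul_eq_mul, mul_one]
    exact hr ▸ Submodule.smul_mem _ r (Submodule.subset_span ⟨x, rfl⟩)

variable {X F : Type*} [NormedAddCommGroup F] [InnerProductSpace ℝ F] {φ : X → F} {k : X → X → ℝ}

theorem IsFeatureMap.norm_sq_eq (hφ : IsFeatureMap k φ) (x : X) : ‖φ x‖ ^ 2 = k x x := by
  rw [← hφ.inner_eq, real_inner_self_eq_norm_sq]

theorem IsFeatureMap.symm (hφ : IsFeatureMap k φ) (x y : X) : k x y = k y x := by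
  rw [← hφ.inner_eq, real_inner_comm, hφ.inner_eq]

theorem IsFeatureMap.gram_eq (hφ : IsFeatureMap k φ) {ℓ : ℕ} (Z : Fin ℓ → X) :
    Matrix.gram ℝ (fun j => φ (Z j)) = gram k Z :=
  Matrix.ext fun i j => hφ.inner_eq (Z i) (Z j)

theorem IsFeatureMap.inner_mercerVector (hφ : IsFeatureMap k φ) {ℓ : ℕ} (Z : Fin ℓ → X)
    (H V : Matrix (Fin ℓ) (Fin ℓ) ℝ) (i : Fin ℓ) (x : X) :
    inner ℝ (φ x) (mercerVector (fun j => φ (Z j)) H V i) = mercerFun k Z H V i x := by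
  rw [real_inner_comm, Nystrom.inner_mercerVector]
  simp only [hφ.inner_eq]
  rfl

theorem IsFeatureMap.inner_sq_le (hφ : IsFeatureMap k φ) (x : X) (g : F) :
    inner ℝ (φ x) g ^ 2 ≤ k x x * ‖g‖ ^ 2 := by
  rw [← hφ.norm_sq_eq, ← mul_pow, ← sq_abs]
  exact pow_le_pow_left₀ (abs_nonneg _) (abs_real_inner_le_norm _ _) 2

variable [MeasurableSpace X] {μ : Measure X}

theorem IsFeatureMap.measurable_inner (hφ : IsFeatureMap k φ) (hk : ∀ y, Measurable (k · y))
    (g : F) : Measurable fun x => inner ℝ (φ x) g := by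
  have hspan : ∀ g ∈ Submodule.span ℝ (Set.range φ), Measurable fun x => inner ℝ (φ x) g := by
    intro g hg
    induction hg using Submodule.span_induction with
    | mem g hg =>
      obtain ⟨y, rfl⟩ := hg
      simpa only [hφ.inner_eq] using hk y
    | zero => simpa only [inner_zero_right] using measurable_const
    | add g g' _ _ h h' =>
      simp_rw [inner_add_right]
      exact h.add h'
    | smul c g _ h =>
      simp_rw [inner_smul_right]
      exact h.const_mul c
  obtain ⟨u, hu, hlim⟩ := mem_closure_iff_seq_limit.1 (hφ.dense_span g)
  exact measurable_of_tendsto_metrizable (fun n => hspan (u n) (hu n))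
    (tendsto_pi_nhds.2 fun x => tendsto_const_nhds.inner hlim)

theorem IsFeatureMap.memLp_inner (hφ : IsFeatureMap k φ) (hk : IsKernel μ k) (g : F) :
    MemLp (fun x => inner ℝ (φ x) g) 2 μ := by
  have hm : AEStronglyMeasurable (fun x => inner ℝ (φ x) g) μ :=
    (hφ.measurable_inner
      (fun _ => hk.measurable.comp measurable_prodMk_right) g).aestronglyMeasurable
  refine (memLp_two_iff_integrable_sq hm).2
    ((hk.integrable_diag.mul_const (‖g‖ ^ 2)).mono' (hm.pow 2) (ae_of_all _ fun x => ?_))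
  rw [Real.norm_of_nonneg (sq_nonneg _)]
  exact hφ.inner_sq_le x g

theorem inner_toLp {f g : X → ℝ} (hf : MemLp f 2 μ) (hg : MemLp g 2 μ) :
    inner ℝ (hf.toLp f) (hg.toLp g) = ∫ x, f x * g x ∂μ := by
  rw [L2.inner_def]
  refine integral_congr_ae ?_
  filter_upwards [hf.coeFn_toLp, hg.coeFn_toLp] with x hfx hgx
  rw [hfx, hgx, RCLike.inner_apply', conj_trivial]

theorem norm_toLp_sq {f : X → ℝ} (hf : MemLp f 2 μ) : ‖hf.toLp f‖ ^ 2 = ∫ x, f x ^ 2 ∂μ := by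
  rw [← real_inner_self_eq_norm_sq, inner_toLp]
  simp only [sq]

/-- The inclusion of the reproducing kernel Hilbert space into `L²(μ)`, sending `g` to the class of
`x ↦ ⟪φ x, g⟫`; it factors the integral operator. -/
noncomputable def featureToLp (hφ : IsFeatureMap k φ) (hk : IsKernel μ k) : F →L[ℝ] Lp ℝ 2 μ :=
  LinearMap.mkContinuous
    { toFun := fun g => (hφ.memLp_inner hk g).toLp
      map_add' := fun g g' => by
        rw [← MemLp.toLp_add]
        exact MemLp.toLp_congr _ _ (ae_of_all _ fun x => inner_add_right _ _ _)
      map_smul' := fun c g => by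
        rw [RingHom.id_apply, ← MemLp.toLp_const_smul]
        exact MemLp.toLp_congr _ _ (ae_of_all _ fun x => inner_smul_right _ _ _) }
    √(∫ x, k x x ∂μ) fun g => by
      refine (pow_le_pow_iff_left₀ (norm_nonneg _) (by positivity) two_ne_zero).1 ?_
      rw [mul_pow, Real.sq_sqrt (integral_nonneg hk.diag_nonneg), ← integral_mul_const]
      refine (norm_toLp_sq (hφ.memLp_inner hk g)).trans_le (integral_mono
        (hφ.memLp_inner hk g).integrable_sq (hk.integrable_diag.mul_const _)
        fun x => hφ.inner_sq_le x g)

theorem featureToLp_apply (hφ : IsFeatureMap k φ) (hk : IsKernel μ k) (g : F) :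
    featureToLp hφ hk g = (hφ.memLp_inner hk g).toLp :=
  rfl

theorem norm_featureToLp_sq (hφ : IsFeatureMap k φ) (hk : IsKernel μ k) (g : F) :
    ‖featureToLp hφ hk g‖ ^ 2 = ∫ x, inner ℝ (φ x) g ^ 2 ∂μ :=
  norm_toLp_sq (hφ.memLp_inner hk g)

theorem isHilbertSchmidt_featureToLp (hφ : IsFeatureMap k φ) (hk : IsKernel μ k) :
    IsHilbertSchmidt (featureToLp hφ hk) := by
  refine ⟨∫ x, k x x ∂μ, fun n v hv => ?_⟩
  have hint : ∀ i, Integrable (fun x => inner ℝ (φ x) (v i) ^ 2) μ := fun i =>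
    (hφ.memLp_inner hk (v i)).integrable_sq
  simp only [norm_featureToLp_sq]
  rw [← integral_finsetSum _ fun i _ => hint i]
  refine integral_mono (integrable_finsetSum _ fun i _ => hint i) hk.integrable_diag fun x => ?_
  simpa only [real_inner_comm, Real.norm_eq_abs, sq_abs, hφ.norm_sq_eq] using
    hv.sum_inner_products_le (φ x) (s := Finset.univ)

theorem gram_featureToLp (hφ : IsFeatureMap k φ) (hk : IsKernel μ k) {ℓ : ℕ} (Z : Fin ℓ → X) :
    Matrix.gram ℝ (fun j => featureToLp hφ hk (φ (Z j))) = gram (squareKernel μ k) Z := by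
  refine Matrix.ext fun i j =>
    (inner_toLp (hφ.memLp_inner hk (φ (Z i))) (hφ.memLp_inner hk (φ (Z j)))).trans ?_
  simp only [hφ.inner_eq, hφ.symm _ (Z i)]
  rfl

theorem integralOperator_eq_featureToLp_comp_adjoint [CompleteSpace F] [SFinite μ]
    (hφ : IsFeatureMap k φ) (hk : IsKernel μ k) :
    integralOperator hk
      = (featureToLp hφ hk ∘L ContinuousLinearMap.adjoint (featureToLp hφ hk) :
          Lp ℝ 2 μ →L[ℝ] Lp ℝ 2 μ) := by
  refine LinearMap.ext fun f => MemLp.toLp_congr (hk.memLp_integral f)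
    (hφ.memLp_inner hk (ContinuousLinearMap.adjoint (featureToLp hφ hk) f))
    (ae_of_all _ fun x => ?_)
  calc ∫ y, k x y * f y ∂μ
      = inner ℝ (featureToLp hφ hk (φ x)) ((Lp.memLp f).toLp f) := by
        rw [featureToLp_apply, inner_toLp]
        simp only [hφ.inner_eq, hφ.symm x]
    _ = inner ℝ (φ x) (ContinuousLinearMap.adjoint (featureToLp hφ hk) f) := by
        rw [Lp.toLp_coeFn, ContinuousLinearMap.adjoint_inner_right]

end FeatureMap

theorem sum_filter_not_lt_eq_sum_Ico {M : Type*} [AddCommMonoid M] (f : ℕ → M) (s ℓ : ℕ) :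
    ∑ i : Fin ℓ with ¬ i.val < s, f i = ∑ i ∈ Finset.Ico s ℓ, f i := by
  rw [Finset.sum_filter, Fin.sum_univ_eq_sum_range (fun i => if ¬ i < s then f i else 0),
    ← Finset.sum_filter]
  congr 1
  grind

section Mercer

variable {X : Type*} {k : X → X → ℝ} {ℓ : ℕ} {Z : Fin ℓ → X} {H V : Matrix (Fin ℓ) (Fin ℓ) ℝ}
  {κ : Fin ℓ → ℝ}

theorem mercerKernel_sub_truncatedMercerKernel (s : ℕ) (x : X) :
    mercerKernel k Z H V κ x x - truncatedMercerKernel k Z H V κ s x x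
      = ∑ i with ¬ i.val < s, κ i * mercerFun k Z H V i x ^ 2 := by
  simp only [mercerKernel, truncatedMercerKernel, mul_assoc, ← sq]
  rw [sub_eq_iff_eq_add', Finset.sum_filter_add_sum_filter_not]

variable [MeasurableSpace X] {μ : Measure X}

theorem IsMercerData.le_eigenvalue [SFinite μ] (hk : IsKernel μ k) {σ : ℕ → ℝ}
    (hσ : IsEigenvalueSequence (integralOperator hk) σ)
    (hκ : IsMercerData μ k Z H V κ) (i : Fin ℓ) : κ i ≤ σ i := by
  obtain ⟨F, _, _, _, φ, hφ⟩ := exists_isFeatureMap hk.posSemidef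
  rw [integralOperator_eq_featureToLp_comp_adjoint hφ hk] at hσ
  exact hσ.le_of_mercerVector (isHilbertSchmidt_featureToLp hφ hk).isCompactOperator
    (hκ.factor.trans (gram_featureToLp hφ hk Z).symm) hκ.orthogonal hκ.antitone hκ.nonneg
    (hφ.gram_eq Z ▸ hκ.svd) i

theorem memLp_mercerFun (hk : IsKernel μ k) (i : Fin ℓ) :
    MemLp (mercerFun k Z H V i) 2 μ := by
  obtain ⟨F, _, _, _, φ, hφ⟩ := exists_isFeatureMap hk.posSemidef
  simpa only [hφ.inner_mercerVector] using
    hφ.memLp_inner hk (mercerVector (fun j => φ (Z j)) H V i)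

theorem integrable_mul_mercerFun_sq (hk : IsKernel μ k) (i : Fin ℓ) :
    Integrable (fun x => κ i * mercerFun k Z H V i x ^ 2) μ :=
  (memLp_mercerFun hk i).integrable_sq.const_mul (κ i)

theorem IsMercerData.integral_mul_mercerFun_sq (hk : IsKernel μ k)
    (hκ : IsMercerData μ k Z H V κ) (i : Fin ℓ) :
    ∫ x, κ i * mercerFun k Z H V i x ^ 2 ∂μ = κ i := by
  obtain ⟨F, _, _, _, φ, hφ⟩ := exists_isFeatureMap hk.posSemidef
  have hnorm := norm_featureToLp_sq hφ hk (mercerVector (fun j => φ (Z j)) H V i)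
  simp only [hφ.inner_mercerVector, map_mercerVector] at hnorm
  rw [integral_const_mul, ← hnorm, mul_norm_mercerVector_sq
    (hκ.factor.trans (gram_featureToLp hφ hk Z).symm) hκ.orthogonal hκ.svd]

theorem integrable_mercerKernel_sub (hk : IsKernel μ k) (s : ℕ) :
    Integrable (fun x => mercerKernel k Z H V κ x x - truncatedMercerKernel k Z H V κ s x x) μ := by
  simp_rw [mercerKernel_sub_truncatedMercerKernel]
  exact integrable_finsetSum _ fun i _ => integrable_mul_mercerFun_sq hk i

theorem IsMercerData.integral_mercerKernel_sub (hk : IsKernel μ k)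
    (hκ : IsMercerData μ k Z H V κ) (s : ℕ) :
    ∫ x, (mercerKernel k Z H V κ x x - truncatedMercerKernel k Z H V κ s x x) ∂μ
      = ∑ i with ¬ i.val < s, κ i := by
  simp_rw [mercerKernel_sub_truncatedMercerKernel]
  rw [integral_finsetSum _ fun i _ => integrable_mul_mercerFun_sq hk i]
  simp_rw [hκ.integral_mul_mercerFun_sq hk]

end Mercer

end Nystrom

theorem theorem4p5_general {X : Type*} [MeasurableSpace X] (μ : Measure X) [SFinite μ]
    (k : X → X → ℝ) (hk : Nystrom.IsKernel μ k)
    (σ : ℕ → ℝ) (hσ : Nystrom.IsEigenvalueSequence (Nystrom.integralOperator hk) σ)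
    (ℓ : ℕ) (Z : Fin ℓ → X)
    (H V : Matrix (Fin ℓ) (Fin ℓ) ℝ) (κ : Fin ℓ → ℝ) (hκ : Nystrom.IsMercerData μ k Z H V κ)
    (s : ℕ) :
    (∀ i : Fin ℓ, κ i ≤ σ i) ∧
    Integrable (fun x => Nystrom.mercerKernel k Z H V κ x x
      - Nystrom.truncatedMercerKernel k Z H V κ s x x) μ ∧
    ∫ x, (Nystrom.mercerKernel k Z H V κ x x
      - Nystrom.truncatedMercerKernel k Z H V κ s x x) ∂μ
      ≤ ∑ i ∈ Finset.Ico s ℓ, σ i := by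
  have hle : ∀ i : Fin ℓ, κ i ≤ σ i := hκ.le_eigenvalue hk hσ
  refine ⟨hle, Nystrom.integrable_mercerKernel_sub hk s, ?_⟩
  rw [hκ.integral_mercerKernel_sub hk, ← Nystrom.sum_filter_not_lt_eq_sum_Ico]
  exact Finset.sum_le_sum fun i _ => hle i

theorem theorem4p5 {X : Type*} [MeasurableSpace X] (μ : Measure X) [IsProbabilityMeasure μ]
    (k : X → X → ℝ) (hk : Nystrom.IsKernel μ k)
    (σ : ℕ → ℝ) (hσ : Nystrom.IsEigenvalueSequence (Nystrom.integralOperator hk) σ)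
    (ℓ : ℕ) (Z : Fin ℓ → X)
    (H V : Matrix (Fin ℓ) (Fin ℓ) ℝ) (κ : Fin ℓ → ℝ) (hκ : Nystrom.IsMercerData μ k Z H V κ)
    (s : ℕ) (hs : s ≤ ℓ) :
    (∀ i : Fin ℓ, κ i ≤ σ i) ∧
    Integrable (fun x => Nystrom.mercerKernel k Z H V κ x x
      - Nystrom.truncatedMercerKernel k Z H V κ s x x) μ ∧
    ∫ x, (Nystrom.mercerKernel k Z H V κ x x
      - Nystrom.truncatedMercerKernel k Z H V κ s x x) ∂μ
      ≤ ∑ i ∈ Finset.Ico s ℓ, σ i :=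
  theorem4p5_general μ k hk σ hσ ℓ Z H V κ hκ s
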